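/- Let $G$ be an arbitrary topological group, with no separation axiom assumed. A continuous $G$-flow is a topological space $X$ with an action of $G$ whose action map $G\times X\to X$ is jointly continuous; morphisms of flows are continuous $G$-equivariant maps. The universal $G$-equivariant compactification of $X$ is its reflection in the compact Hausdorff continuous $G$-flows: a morphism $X\to\beta_G X$ with $\beta_G X$ a compact Hausdorff continuous $G$-flow, through which every morphism from $X$ to a compact Hausdorff continuous $G$-flow factors uniquely. The flow $X$ is called $G$-Tychonoff if the map $X\to\beta_G X$ is a homeomorphism onto its image. Then the category of continuous $G$-Tychonoff flows (a full subcategory of the category of continuous $G$-flows) is cocomplete, i.e. every functor from a small category into it has a colimit. -/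

import Mathlib

open CategoryTheory CategoryTheory.Limits

universe u

/-- An action of `G` on a topological space by continuous maps is (jointly) continuous when the
action map `G × X → X` is continuous. -/
def IsJointlyContinuous {G : Type u} [Monoid G] [TopologicalSpace G] :
    ObjectProperty (Action TopCat.{u} G) := fun X ↦
  Continuous fun p : G × X.V ↦ (X.ρ p.1).hom p.2

/-- The category of continuous `G`-flows: topological spaces (with no separation axiom) carrying an
action of `G` for which the action map `G × X → X` is jointly continuous; the morphisms are the
continuous `G`-equivariant maps. -/
abbrev ContinuousFlow (G : Type u) [Monoid G] [TopologicalSpace G] : Type (u + 1) :=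
  (IsJointlyContinuous (G := G)).FullSubcategory

namespace ContinuousFlow

variable {G : Type u} [Monoid G] [TopologicalSpace G]

/-- The underlying topological space of a flow. -/
abbrev space (X : ContinuousFlow G) : TopCat.{u} := X.obj.V

/-- The underlying continuous map of a morphism of flows. -/
abbrev toContinuousMap {X Y : ContinuousFlow G} (f : X ⟶ Y) : C(X.space, Y.space) :=
  f.hom.hom.hom

/-- A flow is compact Hausdorff when its underlying space is. -/
def IsCompactHausdorff (X : ContinuousFlow G) : Prop :=
  CompactSpace X.space ∧ T2Space X.space

/-- `i : X ⟶ Y` is the universal `G`-equivariant compactification of `X`, i.e. the reflection of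
`X` in the compact Hausdorff continuous `G`-flows: `Y` is a compact Hausdorff flow, and every
morphism from `X` to a compact Hausdorff flow factors uniquely through `i`. (The map `i` is not
required to be injective.) -/
structure IsUniversalCompactification {X Y : ContinuousFlow G} (i : X ⟶ Y) : Prop where
  isCompactHausdorff : Y.IsCompactHausdorff
  existsUnique_fac : ∀ (Z : ContinuousFlow G), Z.IsCompactHausdorff →
    ∀ f : X ⟶ Z, ∃! g : Y ⟶ Z, i ≫ g = f

/-- A flow is `G`-Tychonoff when the map to its universal `G`-equivariant compactification is a
homeomorphism onto its image. -/
def IsTychonoff : ObjectProperty (ContinuousFlow G) := fun X ↦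
  ∃ (Y : ContinuousFlow G) (i : X ⟶ Y),
    IsUniversalCompactification i ∧ Topology.IsEmbedding (toContinuousMap i)

end ContinuousFlow

/-- The category of continuous `G`-Tychonoff flows, a full subcategory of that of continuous
`G`-flows. -/
abbrev TychonoffFlow (G : Type u) [Monoid G] [TopologicalSpace G] : Type (u + 1) :=
  (ContinuousFlow.IsTychonoff (G := G)).FullSubcategory

/-! Colimits of flows formed in spaces can lose joint continuity, since `G × -` need not preserve
quotient maps. So the ambient category is `Action TopCat G`, where each element merely acts
continuously: it is cocomplete because `TopCat` is. The Tychonoff flows are reflective in it, hence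
cocomplete. The reflection of `X` is its image, with the subspace topology, in a compact Hausdorff
flow `B` that is universal for `X` (`exists_compactification`, `exists_tychonoff_reflection`). `B`
is the closure of the image of `X` in a product of a small family of compact Hausdorff flows. -/

namespace ContinuousFlow

open Topology

section Monoid

variable {G : Type u} [Monoid G]

/-- The action of `G` on the points of an object of `Action TopCat G`. -/
instance instMulActionSpace (X : Action TopCat.{u} G) : MulAction G X.V where
  smul g x := (X.ρ g).hom x
  one_smul x := by
    change (X.ρ 1).hom x = x
    rw [map_one]; rfl
  mul_smul g h x := by
    change (X.ρ (g * h)).hom x = (X.ρ g).hom ((X.ρ h).hom x)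
    rw [map_mul]; rfl

instance instContinuousConstSMulSpace (X : Action TopCat.{u} G) : ContinuousConstSMul G X.V :=
  ⟨fun g ↦ (X.ρ g).hom.continuous⟩

lemma map_smul {X Y : Action TopCat.{u} G} (f : X ⟶ Y) (g : G) (x : X.V) :
    f.hom.hom (g • x) = g • f.hom.hom x :=
  congr($(f.comm g).hom x)

/-- A continuous equivariant map, as a morphism of `Action TopCat G`. -/
def homMk {X Y : Action TopCat.{u} G} (f : X.V → Y.V) (hf : Continuous f)
    (h : ∀ (g : G) x, f (g • x) = g • f x) : X ⟶ Y where
  hom := TopCat.ofHom ⟨f, hf⟩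
  comm g := by ext x; exact h g x

lemma action_hom_ext {X Y : Action TopCat.{u} G} {f g : X ⟶ Y}
    (h : ∀ x, f.hom.hom x = g.hom.hom x) : f = g := by
  apply Action.Hom.ext
  ext x
  exact h x

/-- The object of `Action TopCat G` given by a topological space with an action of `G` by continuous
maps. -/
def actionOf (X : Type u) [TopologicalSpace X] [MulAction G X] [ContinuousConstSMul G X] :
    Action TopCat.{u} G where
  V := TopCat.of X
  ρ :=
    { toFun g := TopCat.ofHom ⟨fun x : X ↦ g • x, continuous_const_smul g⟩
      map_one' := TopCat.hom_ext (ContinuousMap.ext fun x ↦ one_smul G x)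
      map_mul' g h := TopCat.hom_ext (ContinuousMap.ext fun x ↦ mul_smul g h x) }

variable [TopologicalSpace G]

instance instContinuousSMulSpace (X : ContinuousFlow G) : ContinuousSMul G X.obj.V :=
  ⟨X.property⟩

/-- The continuous flow given by a topological space with a jointly continuous action of `G`. -/
def of (X : Type u) [TopologicalSpace X] [MulAction G X] [ContinuousSMul G X] :
    ContinuousFlow G :=
  ⟨actionOf X, continuous_smul (M := G) (X := X)⟩

/-- The product of a family of flows. -/
def pi {ι : Type u} (K : ι → ContinuousFlow G) : ContinuousFlow G :=
  of (∀ i, (K i).obj.V)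

/-- The restriction of a flow to an invariant subset. -/
def restrict (X : ContinuousFlow G) (S : SubMulAction G X.obj.V) : ContinuousFlow G :=
  haveI : ContinuousSMul G S := ⟨by
    refine Continuous.subtype_mk ?_ _
    exact continuous_fst.smul (continuous_subtype_val.comp continuous_snd)⟩
  of S

/-- The inclusion of an invariant subset in a flow. -/
def restrictι (X : ContinuousFlow G) (S : SubMulAction G X.obj.V) : X.restrict S ⟶ X :=
  ⟨homMk (X := (X.restrict S).obj) (fun x : S ↦ (x : X.obj.V)) continuous_subtype_val
    fun _ _ ↦ rfl⟩

/-- A morphism whose values lie in an invariant subset, as a morphism to that subset. -/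
def restrictLift {Y : Action TopCat.{u} G} (X : ContinuousFlow G) (S : SubMulAction G X.obj.V)
    (f : Y ⟶ X.obj) (hf : ∀ y, f.hom.hom y ∈ S) : Y ⟶ (X.restrict S).obj :=
  homMk (Y := (X.restrict S).obj) (fun y ↦ (⟨f.hom.hom y, hf y⟩ : S))
    (f.hom.hom.continuous.subtype_mk _) fun g y ↦ Subtype.ext (map_smul f g y)

/-- The closure of the range of an equivariant map, as an invariant subset. -/
def closureRange {Y : Action TopCat.{u} G} (X : ContinuousFlow G) (f : Y ⟶ X.obj) :
    SubMulAction G X.obj.V where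
  carrier := closure (Set.range f.hom.hom)
  smul_mem' g x hx := by
    refine map_mem_closure (continuous_const_smul g) hx ?_
    rintro _ ⟨y, rfl⟩
    exact ⟨g • y, map_smul f g y⟩

/-- The range of an equivariant map, as an invariant subset. -/
def rangeSub {Y : Action TopCat.{u} G} (X : ContinuousFlow G) (f : Y ⟶ X.obj) :
    SubMulAction G X.obj.V where
  carrier := Set.range f.hom.hom
  smul_mem' g x hx := by
    obtain ⟨y, rfl⟩ := hx
    exact ⟨g • y, map_smul f g y⟩

/-- A map `f` to a compact Hausdorff space factors through a dense map `i` to another one if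
ultrafilters with the same limit along `i` have the same limit along `f`. -/
lemma exists_continuous_factor {X B K : Type u} [TopologicalSpace B] [CompactSpace B] [T2Space B]
    [TopologicalSpace K] [CompactSpace K] [T2Space K] {i : X → B} (hi : DenseRange i) {f : X → K}
    (h : ∀ p q : Ultrafilter X, Ultrafilter.extend i p = Ultrafilter.extend i q →
      Ultrafilter.extend f p = Ultrafilter.extend f q) :
    ∃ g : C(B, K), ∀ x, g (i x) = f x := by
  -- The range is compact, hence closed, and contains the dense range of `i`.
  have hsurj : Function.Surjective (Ultrafilter.extend i) := by
    rw [← Set.range_eq_univ, ← (isCompact_range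
      (continuous_ultrafilter_extend i)).isClosed.closure_eq]
    refine (hi.mono ?_).closure_eq
    rintro _ ⟨x, rfl⟩
    exact ⟨pure x, ultrafilter_extend_pure i x⟩
  have hq : IsQuotientMap (Ultrafilter.extend i) :=
    IsQuotientMap.of_surjective_continuous hsurj (continuous_ultrafilter_extend i)
  let F : C(Ultrafilter X, K) := ⟨_, continuous_ultrafilter_extend f⟩
  let I : C(Ultrafilter X, B) := ⟨_, continuous_ultrafilter_extend i⟩
  have hI : IsQuotientMap I := hq
  refine ⟨hI.lift F fun p q ↦ h p q, fun x ↦ ?_⟩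
  have := congr($(hI.lift_comp F fun p q ↦ h p q) (pure x))
  simpa [I, F] using this

/-- Limits of ultrafilters in compact Hausdorff spaces commute with continuous maps. -/
lemma extend_comp {X B K : Type u} [TopologicalSpace B] [CompactSpace B] [T2Space B]
    [TopologicalSpace K] [CompactSpace K] [T2Space K] (i : X → B) {π : B → K} (hπ : Continuous π)
    (p : Ultrafilter X) :
    π (Ultrafilter.extend i p) = Ultrafilter.extend (π ∘ i) p := by
  refine congr_fun (denseRange_pure.equalizer (hπ.comp (continuous_ultrafilter_extend i))
    (continuous_ultrafilter_extend _) ?_) p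
  ext x
  simp

/-- The relation on ultrafilters of points of `X` of having the same limit along a map to a compact
Hausdorff flow. -/
def ultrafilterKernel {X : Action TopCat.{u} G} {K : ContinuousFlow G} (f : X ⟶ K.obj)
    (p q : Ultrafilter X.V) : Prop :=
  Ultrafilter.extend f.hom.hom p = Ultrafilter.extend f.hom.hom q

/-- Every action of `G` by continuous maps has a dense morphism to a compact Hausdorff flow, through
which every morphism to a compact Hausdorff flow factors. -/
theorem exists_compactification (X : Action TopCat.{u} G) :
    ∃ (B : ContinuousFlow G) (i : X ⟶ B.obj), B.IsCompactHausdorff ∧ DenseRange i.hom.hom ∧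
      ∀ (Z : ContinuousFlow G), Z.IsCompactHausdorff → ∀ f : X ⟶ Z.obj,
        ∃ g : B ⟶ Z, i ≫ g.hom = f := by
  -- The targets `K` form a proper class, but their kernels are relations on a fixed set; one
  -- representative per kernel will do.
  let I : Type u := {r : Ultrafilter X.V → Ultrafilter X.V → Prop //
    ∃ (K : ContinuousFlow G) (_ : K.IsCompactHausdorff) (f : X ⟶ K.obj), ultrafilterKernel f = r}
  choose K hK f hf using fun r : I ↦ r.2
  let P : ContinuousFlow G := pi K
  let j : X ⟶ P.obj := homMk (Y := P.obj) (fun x r ↦ (f r).hom.hom x)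
    (continuous_pi fun r ↦ (f r).hom.hom.continuous) fun g x ↦ funext fun r ↦ map_smul (f r) g x
  have := fun r ↦ (hK r).1
  have := fun r ↦ (hK r).2
  have : CompactSpace P.obj.V := inferInstanceAs (CompactSpace (∀ r, (K r).obj.V))
  have : T2Space P.obj.V := inferInstanceAs (T2Space (∀ r, (K r).obj.V))
  let S := closureRange P j
  let B := P.restrict S
  let i : X ⟶ B.obj := restrictLift P S j fun x ↦ subset_closure ⟨x, rfl⟩
  have : CompactSpace B.obj.V := isCompact_iff_compactSpace.1
    (isClosed_closure (s := Set.range j.hom.hom)).isCompact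
  have : T2Space B.obj.V := inferInstanceAs (T2Space S)
  have hi : DenseRange i.hom.hom := by
    have h : closure (Set.range (fun x ↦ (⟨j.hom.hom x, subset_closure ⟨x, rfl⟩⟩ : S))) =
        Set.univ := by
      refine Set.eq_univ_of_forall fun y ↦ ?_
      rw [closure_subtype, ← Set.range_comp]
      exact y.2
    exact dense_iff_closure_eq.2 h
  refine ⟨B, i, ⟨‹_›, ‹_›⟩, hi, fun Z hZ φ ↦ ?_⟩
  have := hZ.1
  have := hZ.2
  let r : I := ⟨ultrafilterKernel φ, Z, hZ, φ, rfl⟩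
  let π : B.obj.V → (K r).obj.V := fun y ↦ (y : S).1 r
  have hπ : Continuous π := (continuous_apply r).comp continuous_subtype_val
  -- Equal limits in `B` have equal coordinates at `r`, and `f r` has the same kernel as `φ`.
  obtain ⟨g, hg⟩ := exists_continuous_factor hi (f := φ.hom.hom) fun p q hpq ↦ by
    have h := congr(π $hpq)
    rw [extend_comp _ hπ, extend_comp _ hπ] at h
    exact (congr_fun₂ (hf r) p q).mp h
  refine ⟨⟨homMk g g.continuous fun a y ↦ ?_⟩, action_hom_ext hg⟩
  -- Equivariance holds on the dense image of `X` and extends because `Z` is Hausdorff.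
  refine congr_fun (hi.equalizer (g.continuous.comp (continuous_const_smul a))
    (g.continuous.const_smul a) ?_) y
  ext x
  change g (a • i.hom.hom x) = a • g (i.hom.hom x)
  rw [← map_smul, hg, hg, map_smul]

/-- Morphisms to a Hausdorff flow that agree on a dense subset are equal. -/
lemma hom_ext_of_denseRange {X : Action TopCat.{u} G} {B Z : ContinuousFlow G} {i : X ⟶ B.obj}
    (hi : DenseRange i.hom.hom) [T2Space Z.obj.V] {g h : B ⟶ Z} (e : i ≫ g.hom = i ≫ h.hom) :
    g = h := by
  apply ObjectProperty.hom_ext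
  refine action_hom_ext fun y ↦ congr_fun (hi.equalizer g.hom.hom.hom.continuous
    h.hom.hom.hom.continuous ?_) y
  ext x
  exact congr(($e).hom.hom x)

/-- Every continuous flow has a universal compactification. -/
theorem exists_isUniversalCompactification (X : ContinuousFlow G) :
    ∃ (B : ContinuousFlow G) (i : X ⟶ B), IsUniversalCompactification i := by
  obtain ⟨B, i, hB, hi, h⟩ := exists_compactification X.obj
  refine ⟨B, ⟨i⟩, hB, fun Z hZ f ↦ ?_⟩
  obtain ⟨g, hg⟩ := h Z hZ f.hom
  have := hZ.2
  refine ⟨g, ObjectProperty.hom_ext _ hg, fun g' hg' ↦ ?_⟩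
  refine hom_ext_of_denseRange hi ?_
  rw [hg, ← hg']
  rfl

/-- A flow that embeds in a compact Hausdorff flow is Tychonoff. -/
theorem isTychonoff_of_isEmbedding {X K : ContinuousFlow G} (hK : K.IsCompactHausdorff)
    (f : X ⟶ K) (hf : IsEmbedding (toContinuousMap f)) : IsTychonoff X := by
  obtain ⟨B, i, hi⟩ := exists_isUniversalCompactification X
  obtain ⟨g, rfl, -⟩ := hi.existsUnique_fac K hK f
  exact ⟨B, i, hi, IsEmbedding.of_comp (toContinuousMap i).continuous
    (toContinuousMap g).continuous hf⟩

/-- Every action of `G` by continuous maps has a reflection in the Tychonoff flows. -/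
theorem exists_tychonoff_reflection (X : Action TopCat.{u} G) :
    ∃ (R : TychonoffFlow G) (p : X ⟶ R.obj.obj), ∀ (T : TychonoffFlow G) (f : X ⟶ T.obj.obj),
      ∃! g : R ⟶ T, p ≫ g.hom.hom = f := by
  obtain ⟨B, i, hB, -, h⟩ := exists_compactification X
  let S := rangeSub B i
  let p : X ⟶ (B.restrict S).obj := restrictLift B S i fun x ↦ ⟨x, rfl⟩
  have hp : Function.Surjective p.hom.hom := by
    rintro ⟨_, x, rfl⟩
    exact ⟨x, rfl⟩
  refine ⟨⟨B.restrict S, isTychonoff_of_isEmbedding hB (B.restrictι S) IsEmbedding.subtypeVal⟩, p,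
    fun T f ↦ ?_⟩
  obtain ⟨K, j, hj, hemb⟩ := T.property
  obtain ⟨g, hg⟩ := h K hj.isCompactHausdorff (f ≫ j.hom)
  have hg' (x : X.V) : g.hom.hom.hom (i.hom.hom x) = j.hom.hom.hom (f.hom.hom x) :=
    congr(($hg).hom.hom x)
  -- The section `s` need be neither continuous nor equivariant: after the embedding `j`, the map `f
  -- ∘ s` becomes the restriction of `g`, which is both.
  choose s hs using hp
  have hjs (y : (B.restrict S).obj.V) :
      j.hom.hom.hom (f.hom.hom (s y)) = (B.restrictι S ≫ g).hom.hom.hom y := by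
    rw [← hg']
    exact congr((B.restrictι S ≫ g).hom.hom.hom $(hs y))
  let k : (B.restrict S).obj ⟶ T.obj.obj := homMk (fun y ↦ f.hom.hom (s y))
    (hemb.continuous_iff.2 <| by
      convert (B.restrictι S ≫ g).hom.hom.hom.continuous using 1
      exact funext hjs)
    fun a y ↦ hemb.injective <| by
      change j.hom.hom.hom _ = j.hom.hom.hom _
      rw [map_smul, hjs, hjs, map_smul]
  refine ⟨⟨⟨k⟩⟩, action_hom_ext fun x ↦ hemb.injective ?_, fun k' hk' ↦ ?_⟩
  · exact (hjs (p.hom.hom x)).trans (hg' x)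
  · apply ObjectProperty.hom_ext
    apply ObjectProperty.hom_ext
    refine action_hom_ext fun y ↦ ?_
    obtain rfl := hk'
    conv_lhs => rw [← hs y]
    rfl

/-- The inclusion of the Tychonoff flows in the actions of `G` by continuous maps. -/
abbrev tychonoffInclusion (G : Type u) [Monoid G] [TopologicalSpace G] :
    TychonoffFlow G ⥤ Action TopCat.{u} G :=
  (IsTychonoff (G := G)).ι ⋙ (IsJointlyContinuous (G := G)).ι

instance isRightAdjoint_tychonoffInclusion : (tychonoffInclusion G).IsRightAdjoint := by
  rw [isRightAdjoint_iff_hasInitial_structuredArrow]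
  intro X
  obtain ⟨R, p, h⟩ := exists_tychonoff_reflection X
  choose g hg hg' using h
  refine IsInitial.hasInitial (X := StructuredArrow.mk (T := tychonoffInclusion G) (Y := R) p) ?_
  exact IsInitial.ofUniqueHom
    (fun T ↦ StructuredArrow.homMk (g T.right T.hom) (hg _ _))
    fun T m ↦ StructuredArrow.ext _ _ (hg' _ _ _ (StructuredArrow.w m))

end Monoid

end ContinuousFlow

/-- For every topological group `G` (no separation axiom), the category of continuous
`G`-Tychonoff flows has all small colimits. -/
theorem corollary2p11 (G : Type u) [Group G] [TopologicalSpace G] [IsTopologicalGroup G] :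
    HasColimitsOfSize.{u, u} (TychonoffFlow G) := by
  let _ : Reflective (ContinuousFlow.tychonoffInclusion G) :=
    { L := _, adj := Adjunction.ofIsRightAdjoint _ }
  -- A colimit is the reflection of the one taken in `Action TopCat G`.
  exact hasColimits_of_reflective (ContinuousFlow.tychonoffInclusion G)
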